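/- Let $d\in\mathbb{N}$ and let $\Omega\subset\mathbb{C}^d$ be a domain (a non-empty connected open set, not necessarily bounded). Let $\mathsf{k}_\Omega$ be its Kobayashi pseudodistance, i.e. $\mathsf{k}_\Omega(z,w)$ is the infimum of $\sum_j \mathsf{k}_{\mathbb{D}}(\zeta_j,\xi_j)$ over finite chains of holomorphic maps $f_j:\mathbb{D}\to\Omega$ with points $\zeta_j,\xi_j\in\mathbb{D}$ such that the chain $f_1(\zeta_1)=z$, $f_j(\xi_j)=f_{j+1}(\zeta_{j+1})$ ends at $w$, where $\mathsf{k}_{\mathbb{D}}(\zeta,\xi)=\frac12\log\frac{1+\rho}{1-\rho}$ with $\rho=\left|\frac{\zeta-\xi}{1-\bar\xi\zeta}\right|$. Suppose that - $\Omega$ is complete Kobayashi hyperbolic, i.e. $\mathsf{k}_\Omega$ is a distance on $\Omega$ and $(\Omega,\mathsf{k}_\Omega)$ is Cauchy-complete; - $\Omega$ has the visibility property with respect to the geodesics of $\mathsf{k}_\Omega$, i.e. for any two distinct points $x,y\in\partial\Omega$ there are disjoint neighbourhoods $U_x,U_y$ of $x,y$ in $\mathbb{C}^d$ and a compact set $K\subset\Omega$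 such that every geodesic $\gamma:[a,b]\to\Omega$ (that is, $\mathsf{k}_\Omega(\gamma(s),\gamma(t))=|s-t|$ for all $s,t\in[a,b]$) with $\gamma(a)\in U_x$ and $\gamma(b)\in U_y$ meets $K$. For $o\in\Omega$, $x\in\partial\Omega$ and $R>0$ let $$H^b_o(x,R)=\Big\{z\in\Omega:\ \liminf_{w\to x,\ w\in\Omega}\big(\mathsf{k}_\Omega(z,w)-\mathsf{k}_\Omega(o,w)\big)<\tfrac12\log R\Big\}$$ be the big horosphere with centre $x$, pole $o$ and radius $R$. Then for all $o\in\Omega$, $x\in\partial\Omega$ and $R>0$, $$\overline{H^b_o(x,R)}\cap\partial\Omega=\{x\},$$ where closure and boundary are taken in $\mathbb{C}^d$. -/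

import Mathlib

open Filter Topology Metric

noncomputable section

namespace Kobayashi

/-- The Poincaré distance of the unit disc, normalised so that
`poincareDist 0 r = (1/2) * log ((1 + r) / (1 - r))` for `0 ≤ r < 1`. -/
def poincareDist (ζ ξ : ℂ) : ℝ :=
  (1 / 2) * Real.log
    ((1 + ‖(ζ - ξ) / (1 - (starRingEnd ℂ) ξ * ζ)‖) /
      (1 - ‖(ζ - ξ) / (1 - (starRingEnd ℂ) ξ * ζ)‖))

/-- `DiscChain Ω z w ℓ`: there is a finite chain of holomorphic discs in `Ω` that joins `z` to `w`
and has total length `ℓ`, the sum of the Poincaré distances between the marked points. -/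
inductive DiscChain {d : ℕ} (Ω : Set (EuclideanSpace ℂ (Fin d))) :
    EuclideanSpace ℂ (Fin d) → EuclideanSpace ℂ (Fin d) → ℝ → Prop
  | nil (z : EuclideanSpace ℂ (Fin d)) (hz : z ∈ Ω) : DiscChain Ω z z 0
  | cons (z z' w : EuclideanSpace ℂ (Fin d)) (ℓ : ℝ)
      (f : ℂ → EuclideanSpace ℂ (Fin d)) (ζ ξ : ℂ)
      (hf : DifferentiableOn ℂ f (ball 0 1)) (hfΩ : Set.MapsTo f (ball 0 1) Ω)
      (hζ : ζ ∈ ball (0 : ℂ) 1) (hξ : ξ ∈ ball (0 : ℂ) 1)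
      (hz : f ζ = z) (hz' : f ξ = z') (tail : DiscChain Ω z' w ℓ) :
      DiscChain Ω z w (poincareDist ζ ξ + ℓ)

/-- The Kobayashi pseudodistance of a domain `Ω ⊆ ℂᵈ`. The set of lengths is bounded below by `0`,
and it is non-empty for `z, w ∈ Ω` when `Ω` is open and connected. -/
def kobayashiDist {d : ℕ} (Ω : Set (EuclideanSpace ℂ (Fin d)))
    (z w : EuclideanSpace ℂ (Fin d)) : ℝ :=
  sInf {ℓ : ℝ | DiscChain Ω z w ℓ}

/-- `Ω` is Kobayashi hyperbolic: the Kobayashi pseudodistance separates points. -/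
def IsHyperbolic {d : ℕ} (Ω : Set (EuclideanSpace ℂ (Fin d))) : Prop :=
  ∀ z ∈ Ω, ∀ w ∈ Ω, kobayashiDist Ω z w = 0 → z = w

/-- `Ω` is complete Kobayashi hyperbolic: the Kobayashi pseudodistance is a distance, and every
Cauchy sequence for it converges in `Ω` for it. -/
def IsCompleteHyperbolic {d : ℕ} (Ω : Set (EuclideanSpace ℂ (Fin d))) : Prop :=
  IsHyperbolic Ω ∧
    ∀ u : ℕ → EuclideanSpace ℂ (Fin d), (∀ n, u n ∈ Ω) →
      (∀ ε > 0, ∃ N, ∀ m ≥ N, ∀ n ≥ N, kobayashiDist Ω (u m) (u n) < ε) →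
      ∃ p ∈ Ω, Tendsto (fun n => kobayashiDist Ω (u n) p) atTop (𝓝 0)

/-- `γ`, restricted to `[a, b]`, is a geodesic of the Kobayashi distance of `Ω`. -/
def IsGeodesicOn {d : ℕ} (Ω : Set (EuclideanSpace ℂ (Fin d)))
    (γ : ℝ → EuclideanSpace ℂ (Fin d)) (a b : ℝ) : Prop :=
  Set.MapsTo γ (Set.Icc a b) Ω ∧
    ∀ s ∈ Set.Icc a b, ∀ t ∈ Set.Icc a b, kobayashiDist Ω (γ s) (γ t) = |s - t|

/-- The visibility property with respect to the geodesics of the Kobayashi distance. -/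
def HasGeodesicVisibility {d : ℕ} (Ω : Set (EuclideanSpace ℂ (Fin d))) : Prop :=
  ∀ x ∈ frontier Ω, ∀ y ∈ frontier Ω, x ≠ y →
    ∃ U ∈ 𝓝 x, ∃ V ∈ 𝓝 y, Disjoint U V ∧
      ∃ K : Set (EuclideanSpace ℂ (Fin d)), IsCompact K ∧ K ⊆ Ω ∧
        ∀ (γ : ℝ → EuclideanSpace ℂ (Fin d)) (a b : ℝ), a ≤ b → IsGeodesicOn Ω γ a b →
          γ a ∈ U → γ b ∈ V → ∃ t ∈ Set.Icc a b, γ t ∈ K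

/-- The big horosphere with centre `x`, pole `o` and radius `R`. The lower limit is taken as
`w → x` within `Ω`, in the extended reals. -/
def bigHorosphere {d : ℕ} (Ω : Set (EuclideanSpace ℂ (Fin d)))
    (o x : EuclideanSpace ℂ (Fin d)) (R : ℝ) : Set (EuclideanSpace ℂ (Fin d)) :=
  {z | z ∈ Ω ∧
    liminf (fun w => ((kobayashiDist Ω z w - kobayashiDist Ω o w : ℝ) : EReal)) (𝓝[Ω] x) <
      (((1 / 2) * Real.log R : ℝ) : EReal)}

end Kobayashi

end

/-! Write k for the Kobayashi distance. Chains of discs carry 1-Lipschitz paths, so a hyperbolic Ω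
is a length space whose topology is Euclidean. Hopf–Rinow then makes closed k-balls compact and
provides geodesics; in particular k(o, ·) tends to infinity at each boundary point.

No other boundary point (`eq_of_mem_closure_bigHorosphere`): let y ≠ x, take z in the horosphere
near y, and w near x with k(z,w) - k(o,w) < ½ log R. By visibility a geodesic from z to w meets a
fixed compact K, on which k(o, ·) ≤ C. Passing through that point gives k(z,w) ≥ k(o,z) + k(o,w) -
2C, so k(o,z) < ½ log R + 2C, which fails for z close to y.

The centre is reached (`mem_closure_bigHorosphere`): on a geodesic from o to w, the point g at time
t satisfies k(g,w) - k(o,w) = -t. By visibility g is near x once t is large, uniformly for w near x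
(`exists_forall_isGeodesicOn_dist_lt`). For fixed t these points stay in a compact ball, and a
cluster point as w → x lies in the horosphere and near x. -/

/-! ### Length metric spaces -/

/-- Any two points are joined by `1`-Lipschitz paths of length arbitrarily close to their
distance. -/
def IsLengthSpace (X : Type*) [MetricSpace X] : Prop :=
  ∀ x y : X, ∀ r, dist x y < r → ∃ ℓ, 0 ≤ ℓ ∧ ℓ < r ∧
    ∃ c : ℝ → X, LipschitzWith 1 c ∧ c 0 = x ∧ c ℓ = y

namespace IsLengthSpace

variable {X : Type*} [MetricSpace X]

lemma exists_dist_le_dist_lt (hX : IsLengthSpace X) {x y : X} {r s : ℝ} (hr : 0 ≤ r) (hs : 0 < s)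
    (h : dist x y < r + s) : ∃ z, dist z x ≤ r ∧ dist z y < s := by
  obtain ⟨ℓ, hℓ0, hℓ, c, hc, rfl, rfl⟩ := hX x y _ h
  have hd : ∀ a b, dist (c a) (c b) ≤ |a - b| := fun a b => by
    simpa [Real.dist_eq] using hc.dist_le_mul a b
  rcases le_total r ℓ with hrl | hrl
  · refine ⟨c r, (hd _ _).trans (by simp [abs_of_nonneg hr]), (hd _ _).trans_lt ?_⟩
    rw [abs_of_nonpos (by linarith)]
    linarith
  · exact ⟨c ℓ, (hd _ _).trans (by simpa [abs_of_nonneg hℓ0] using hrl), by simpa using hs⟩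

/-- Each point of the ball is within ε/2 of a slightly smaller compact ball, so a finite ε/2-net of
the latter is an ε-net of the former. -/
lemma isCompact_closedBall_of_forall_lt [CompleteSpace X] (hX : IsLengthSpace X) {x : X} {r : ℝ}
    (h : ∀ r' < r, IsCompact (closedBall x r')) : IsCompact (closedBall x r) := by
  rcases lt_trichotomy r 0 with hr | rfl | hr
  · simp [closedBall_eq_empty.2 hr]
  · simp
  refine isCompact_iff_totallyBounded_isComplete.2 ⟨?_, isClosed_closedBall.isComplete⟩
  rw [Metric.totallyBounded_iff]
  intro ε hε
  set δ := min (ε / 4) r with hδ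
  have hδ0 : 0 < δ := lt_min (by linarith) hr
  have hδε : δ ≤ ε / 4 := min_le_left _ _
  have hδr : δ ≤ r := min_le_right _ _
  obtain ⟨t, ht, hcov⟩ := Metric.totallyBounded_iff.1 (h (r - δ) (by linarith)).totallyBounded
    (ε / 2) (by linarith)
  refine ⟨t, ht, fun y hy => ?_⟩
  rw [mem_closedBall, dist_comm] at hy
  obtain ⟨z, hzx, hzy⟩ := hX.exists_dist_le_dist_lt (x := x) (y := y) (r := r - δ) (s := ε / 2)
    (by linarith) (by linarith) (by linarith)
  obtain ⟨i, hi, hzi⟩ := Set.mem_iUnion₂.1 (hcov (mem_closedBall.2 hzx))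
  refine Set.mem_iUnion₂.2 ⟨i, hi, ?_⟩
  rw [mem_ball] at hzi ⊢
  linarith [dist_triangle_left y i z]

/-- A compact ball has a compact neighbourhood, which contains a uniform thickening; in a length
space a thickening contains a larger ball. -/
lemma exists_isCompact_closedBall_add [LocallyCompactSpace X] (hX : IsLengthSpace X) {x : X}
    {r : ℝ} (hr : 0 ≤ r) (h : IsCompact (closedBall x r)) :
    ∃ δ > 0, IsCompact (closedBall x (r + δ)) := by
  obtain ⟨K, hK, hsub⟩ := exists_compact_superset h
  obtain ⟨δ, hδ, hthick⟩ := h.exists_thickening_subset_open isOpen_interior hsub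
  refine ⟨δ / 2, by linarith, hK.of_isClosed_subset isClosed_closedBall fun y hy => ?_⟩
  rw [mem_closedBall, dist_comm] at hy
  obtain ⟨z, hzx, hzy⟩ := hX.exists_dist_le_dist_lt (x := x) (y := y) hr hδ (by linarith)
  refine interior_subset (hthick (mem_thickening_iff.2 ⟨z, mem_closedBall.2 hzx, ?_⟩))
  rwa [dist_comm]

/-- **Hopf–Rinow–Cohn-Vossen**: a complete, locally compact length space is proper. -/
theorem properSpace [CompleteSpace X] [LocallyCompactSpace X] (hX : IsLengthSpace X) :
    ProperSpace X := by
  refine ⟨fun x r₀ => ?_⟩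
  by_contra hr₀
  set S := {r | ¬ IsCompact (closedBall x r)} with hS
  have hpos : ∀ r ∈ S, 0 ≤ r := fun r hr => by
    by_contra! h
    exact hr (by simp [closedBall_eq_empty.2 h])
  have hbdd : BddBelow S := ⟨0, hpos⟩
  -- The ball at the infimum of the bad radii is itself compact, so compactness extends past the
  -- infimum: a contradiction.
  have hinf : IsCompact (closedBall x (sInf S)) :=
    hX.isCompact_closedBall_of_forall_lt fun r' hr' =>
      not_not.1 (notMem_of_lt_csInf (s := S) hr' hbdd)
  obtain ⟨δ, hδ, hc⟩ := hX.exists_isCompact_closedBall_add (le_csInf ⟨r₀, hr₀⟩ hpos) hinf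
  obtain ⟨r, hr, hlt⟩ := exists_lt_of_csInf_lt (s := S) ⟨r₀, hr₀⟩ (lt_add_of_pos_right _ hδ)
  exact hr (hc.of_isClosed_subset isClosed_closedBall (closedBall_subset_closedBall hlt.le))

/-- In a proper length space any two points are joined by a geodesic. -/
theorem exists_geodesic [ProperSpace X] (hX : IsLengthSpace X) (x y : X) :
    ∃ γ : ℝ → X, γ 0 = x ∧ γ (dist x y) = y ∧
      ∀ s ∈ Set.Icc 0 (dist x y), ∀ t ∈ Set.Icc 0 (dist x y), dist (γ s) (γ t) = |s - t| := by
  set L := dist x y with hL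
  have hL0 : 0 ≤ L := dist_nonneg
  -- Curves 1-Lipschitz on `[0, L]` that almost end at `y`, as a closed subset of a product of
  -- compact balls. Tychonoff replaces Arzelà–Ascoli.
  let C : ℕ → Set (ℝ → X) := fun n =>
    {γ | γ ∈ Set.univ.pi (fun _ => closedBall x L) ∧ γ 0 = x ∧ dist (γ L) y ≤ 1 / ((n : ℝ) + 1) ∧
      ∀ s ∈ Set.Icc 0 L, ∀ t ∈ Set.Icc 0 L, dist (γ s) (γ t) ≤ |s - t|}
  have hclosed : ∀ n, IsClosed (C n) := by
    intro n
    have e : C n = Set.univ.pi (fun _ => closedBall x L) ∩ ({γ | γ 0 = x} ∩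
        ({γ | dist (γ L) y ≤ 1 / ((n : ℝ) + 1)} ∩
          ⋂ s ∈ Set.Icc 0 L, ⋂ t ∈ Set.Icc 0 L, {γ | dist (γ s) (γ t) ≤ |s - t|})) := by
      ext γ
      simp only [C, Set.mem_inter_iff, Set.mem_iInter, Set.mem_ofPred_eq]
    rw [e]
    exact (isClosed_set_pi fun _ _ => isClosed_closedBall).inter <|
      (isClosed_eq (continuous_apply 0) continuous_const).inter <|
      (isClosed_le ((continuous_apply L).dist continuous_const) continuous_const).inter <|
      isClosed_biInter fun s _ => isClosed_biInter fun t _ =>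
        isClosed_le ((continuous_apply s).dist (continuous_apply t)) continuous_const
  have hcompact : IsCompact (C 0) :=
    (isCompact_univ_pi fun _ => isCompact_closedBall x L).of_isClosed_subset (hclosed 0)
      fun γ hγ => hγ.1
  have hanti : ∀ n, C (n + 1) ⊆ C n := by
    rintro n γ ⟨h1, h2, h3, h4⟩
    refine ⟨h1, h2, h3.trans ?_, h4⟩
    apply one_div_le_one_div_of_le <;> push_cast <;> linarith [n.cast_nonneg (α := ℝ)]
  have hne : ∀ n, (C n).Nonempty := by
    intro n
    have hn : 0 < 1 / ((n : ℝ) + 1) := Nat.one_div_pos_of_nat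
    obtain ⟨ℓ, hℓ0, hℓ, c, hc, hc0, hcℓ⟩ := hX x y (L + 1 / ((n : ℝ) + 1)) (by linarith)
    have hd : ∀ a b, dist (c a) (c b) ≤ |a - b| := fun a b => by
      simpa [Real.dist_eq] using hc.dist_le_mul a b
    have hLℓ : L ≤ ℓ := by
      have := hd 0 ℓ
      rwa [hc0, hcℓ, zero_sub, abs_neg, abs_of_nonneg hℓ0] at this
    -- Clamping time to `[0, L]` keeps every value in the ball and moves the endpoint by at most `ℓ
    -- - L < 1 / (n + 1)`.
    refine ⟨fun s => c (max 0 (min s L)), ?_, ?_, ?_, ?_⟩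
    · intro s _
      rw [mem_closedBall, ← hc0]
      refine (hd _ _).trans ?_
      rw [sub_zero, abs_of_nonneg (le_max_left _ _)]
      exact max_le hL0 (min_le_right _ _)
    · simp [hL0, hc0]
    · simp only [min_self, max_eq_right hL0]
      rw [← hcℓ]
      refine (hd _ _).trans ?_
      rw [abs_of_nonpos (by linarith)]
      linarith
    · rintro s ⟨hs0, hsL⟩ t ⟨ht0, htL⟩
      simp only [min_eq_left hsL, min_eq_left htL, max_eq_right hs0, max_eq_right ht0]
      exact hd s t
  obtain ⟨γ, hγ⟩ := IsCompact.nonempty_iInter_of_sequence_nonempty_isCompact_isClosed C hanti hne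
    hcompact hclosed
  rw [Set.mem_iInter] at hγ
  have h0 : γ 0 = x := (hγ 0).2.1
  have h1 : γ L = y := by
    refine dist_le_zero.1 (ge_of_tendsto' tendsto_one_div_add_atTop_nhds_zero_nat fun n => ?_)
    exact (hγ n).2.2.1
  have hle := (hγ 0).2.2.2
  -- A 1-Lipschitz curve covering distance `L` in time `L` can lose nothing on any subinterval.
  have key : ∀ s ∈ Set.Icc 0 L, ∀ t ∈ Set.Icc 0 L, s ≤ t → dist (γ s) (γ t) = |s - t| := by
    intro s hs t ht hst
    refine le_antisymm (hle s hs t ht) ?_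
    have a1 := hle 0 ⟨le_rfl, hL0⟩ s hs
    have a2 := hle t ht L ⟨hL0, le_rfl⟩
    rw [h0, abs_of_nonpos (by linarith [hs.1])] at a1
    rw [h1, abs_of_nonpos (by linarith [ht.2])] at a2
    rw [abs_of_nonpos (by linarith)]
    have := dist_triangle4 x (γ s) (γ t) y
    linarith
  refine ⟨γ, h0, h1, fun s hs t ht => ?_⟩
  rcases le_total s t with h | h
  · exact key s hs t ht h
  · rw [dist_comm, abs_sub_comm]
    exact key t ht s hs h

end IsLengthSpace

namespace Kobayashi

/-! ### The Poincaré distance of the unit disc -/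

/-- The identity behind the fact that a Möbius map preserves the disc: the right side is positive
inside it. -/
lemma normSq_one_add_conj_mul_sub (ζ a : ℂ) :
    Complex.normSq (1 + (starRingEnd ℂ) ζ * a) - Complex.normSq (a + ζ) =
      (1 - Complex.normSq a) * (1 - Complex.normSq ζ) := by
  simp only [Complex.normSq_apply, Complex.add_re, Complex.add_im, Complex.mul_re, Complex.mul_im,
    Complex.conj_re, Complex.conj_im, Complex.one_re, Complex.one_im]
  ring

lemma normSq_lt_one_of_mem_ball {ζ : ℂ} (hζ : ζ ∈ ball (0 : ℂ) 1) : Complex.normSq ζ < 1 := by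
  rw [mem_ball_zero_iff] at hζ
  rw [Complex.normSq_eq_norm_sq]
  exact pow_lt_one₀ (norm_nonneg _) hζ two_ne_zero

lemma norm_add_lt_norm_one_add_conj_mul {ζ a : ℂ} (hζ : ζ ∈ ball (0 : ℂ) 1)
    (ha : a ∈ ball (0 : ℂ) 1) : ‖a + ζ‖ < ‖1 + (starRingEnd ℂ) ζ * a‖ := by
  have h := normSq_one_add_conj_mul_sub ζ a
  have h1 := normSq_lt_one_of_mem_ball hζ
  have h2 := normSq_lt_one_of_mem_ball ha
  have h3 : 0 < (1 - Complex.normSq a) * (1 - Complex.normSq ζ) :=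
    mul_pos (by linarith) (by linarith)
  rw [Complex.normSq_eq_norm_sq, Complex.normSq_eq_norm_sq] at h
  exact lt_of_pow_lt_pow_left₀ 2 (norm_nonneg _) (by linarith)

lemma one_add_conj_mul_ne_zero {ζ a : ℂ} (hζ : ζ ∈ ball (0 : ℂ) 1) (ha : a ∈ ball (0 : ℂ) 1) :
    1 + (starRingEnd ℂ) ζ * a ≠ 0 :=
  norm_pos_iff.1 ((norm_nonneg _).trans_lt (norm_add_lt_norm_one_add_conj_mul hζ ha))

/-- The disc automorphism that sends `0` to `ζ`. -/
noncomputable def discShift (ζ a : ℂ) : ℂ := (a + ζ) / (1 + (starRingEnd ℂ) ζ * a)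

lemma discShift_mem_ball {ζ a : ℂ} (hζ : ζ ∈ ball (0 : ℂ) 1) (ha : a ∈ ball (0 : ℂ) 1) :
    discShift ζ a ∈ ball (0 : ℂ) 1 := by
  have h := norm_add_lt_norm_one_add_conj_mul hζ ha
  rw [mem_ball_zero_iff, discShift, norm_div, div_lt_one ((norm_nonneg _).trans_lt h)]
  exact h

lemma differentiableOn_discShift {ζ : ℂ} (hζ : ζ ∈ ball (0 : ℂ) 1) :
    DifferentiableOn ℂ (discShift ζ) (ball 0 1) := by
  unfold discShift
  exact DifferentiableOn.div (by fun_prop) (by fun_prop) fun a ha => one_add_conj_mul_ne_zero hζ ha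

lemma neg_mem_unit_ball {ζ : ℂ} (hζ : ζ ∈ ball (0 : ℂ) 1) : -ζ ∈ ball (0 : ℂ) 1 := by
  simpa using hζ

lemma discShift_discShift_neg {ζ ξ : ℂ} (hζ : ζ ∈ ball (0 : ℂ) 1) (hξ : ξ ∈ ball (0 : ℂ) 1) :
    discShift ζ (discShift (-ζ) ξ) = ξ := by
  have h1 := one_add_conj_mul_ne_zero (neg_mem_unit_ball hζ) hξ
  have h2 := one_add_conj_mul_ne_zero hζ (discShift_mem_ball (neg_mem_unit_ball hζ) hξ)
  simp only [discShift, map_neg, neg_mul, ← sub_eq_add_neg] at h1 h2 ⊢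
  rw [div_eq_iff h2]
  linear_combination div_mul_cancel₀ (ξ - ζ) h1

lemma poincareDist_eq_artanh {ζ ξ : ℂ} (hζ : ζ ∈ ball (0 : ℂ) 1) (hξ : ξ ∈ ball (0 : ℂ) 1) :
    poincareDist ζ ξ = Real.artanh ‖discShift (-ξ) ζ‖ := by
  have h := mem_ball_zero_iff.1 (discShift_mem_ball (neg_mem_unit_ball hξ) hζ)
  rw [Real.artanh_eq_half_log ⟨by linarith [norm_nonneg (discShift (-ξ) ζ)], h.le⟩]
  simp [poincareDist, discShift, sub_eq_add_neg]

lemma poincareDist_nonneg {ζ ξ : ℂ} (hζ : ζ ∈ ball (0 : ℂ) 1) (hξ : ξ ∈ ball (0 : ℂ) 1) :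
    0 ≤ poincareDist ζ ξ := by
  rw [poincareDist_eq_artanh hζ hξ]
  exact Real.artanh_nonneg (norm_nonneg _)

lemma poincareDist_comm (ζ ξ : ℂ) : poincareDist ζ ξ = poincareDist ξ ζ := by
  have h : ‖(ζ - ξ) / (1 - (starRingEnd ℂ) ξ * ζ)‖ = ‖(ξ - ζ) / (1 - (starRingEnd ℂ) ζ * ξ)‖ := by
    rw [norm_div, norm_div, norm_sub_rev, ← Complex.norm_conj (1 - (starRingEnd ℂ) ξ * ζ)]
    simp [mul_comm]
  simp only [poincareDist, h]

lemma tanh_sub_eq (s t : ℝ) :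
    Real.tanh (s - t) = (Real.tanh s - Real.tanh t) / (1 - Real.tanh t * Real.tanh s) := by
  have hs := (Real.cosh_pos s).ne'
  have ht := (Real.cosh_pos t).ne'
  have hst := (Real.cosh_pos (s - t)).ne'
  have h : 1 - Real.tanh t * Real.tanh s ≠ 0 := by
    have := abs_lt.1 (abs_mul (Real.tanh t) (Real.tanh s) ▸
      mul_lt_one_of_nonneg_of_lt_one_left (abs_nonneg _) (Real.abs_tanh_lt_one t)
        (Real.abs_tanh_lt_one s).le)
    linarith [this.2]
  rw [eq_div_iff h]
  simp only [Real.tanh_eq_sinh_div_cosh]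
  field_simp
  rw [Real.sinh_sub, Real.cosh_sub]
  ring

lemma ofReal_tanh_mem_ball (t : ℝ) : (Real.tanh t : ℂ) ∈ ball (0 : ℂ) 1 := by
  rw [mem_ball_zero_iff, Complex.norm_real]
  exact Real.abs_tanh_lt_one t

/-- `tanh` parametrises the real diameter by hyperbolic arc length, by its subtraction formula. -/
lemma poincareDist_tanh (s t : ℝ) : poincareDist (Real.tanh s) (Real.tanh t) = |s - t| := by
  rw [poincareDist_eq_artanh (ofReal_tanh_mem_ball s) (ofReal_tanh_mem_ball t)]
  have h : discShift (-(Real.tanh t : ℂ)) (Real.tanh s) = (Real.tanh (s - t) : ℝ) := by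
    rw [tanh_sub_eq]
    simp only [discShift, map_neg, Complex.conj_ofReal]
    push_cast
    ring
  have h' : ‖((Real.tanh (s - t) : ℝ) : ℂ)‖ = Real.tanh |s - t| := by
    rw [Complex.norm_real, Real.norm_eq_abs]
    rcases le_total 0 (s - t) with h0 | h0
    · rw [abs_of_nonneg h0, abs_of_nonneg]
      rw [Real.tanh_eq_sinh_div_cosh]
      exact div_nonneg (Real.sinh_nonneg_iff.2 h0) (Real.cosh_pos _).le
    · rw [abs_of_nonpos h0, Real.tanh_neg, abs_of_nonpos]
      rw [Real.tanh_eq_sinh_div_cosh]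
      exact div_nonpos_of_nonpos_of_nonneg (Real.sinh_nonpos_iff.2 h0) (Real.cosh_pos _).le
  rw [h, h', Real.artanh_tanh]

lemma continuous_real_tanh : Continuous Real.tanh := by
  have : Real.tanh = fun x => Real.sinh x / Real.cosh x :=
    funext Real.tanh_eq_sinh_div_cosh
  rw [this]
  exact Real.continuous_sinh.div Real.continuous_cosh fun x => (Real.cosh_pos x).ne'

/-- Any two points of the disc lie, at parameters `0` and `artanh r`, on the image of the real
diameter under a disc automorphism. -/
lemma exists_disc_automorphism {ζ ξ : ℂ} (hζ : ζ ∈ ball (0 : ℂ) 1) (hξ : ξ ∈ ball (0 : ℂ) 1) :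
    ∃ φ : ℂ → ℂ, DifferentiableOn ℂ φ (ball 0 1) ∧ Set.MapsTo φ (ball 0 1) (ball 0 1) ∧
      φ (Real.tanh 0) = ζ ∧ φ (Real.tanh (poincareDist ζ ξ)) = ξ := by
  set m := discShift (-ζ) ξ with hm
  have hmb : m ∈ ball (0 : ℂ) 1 := discShift_mem_ball (neg_mem_unit_ball hζ) hξ
  -- Rotation turning the positive real axis towards `m`.
  obtain ⟨u, hu, hum⟩ : ∃ u : ℂ, ‖u‖ = 1 ∧ u * ‖m‖ = m := by
    rcases eq_or_ne m 0 with h | h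
    · exact ⟨1, by simp, by simp [h]⟩
    · refine ⟨m / ‖m‖, ?_, ?_⟩
      · simp [h]
      · have : (‖m‖ : ℂ) ≠ 0 := by simpa using h
        field_simp
  have hmaps : Set.MapsTo (fun a : ℂ => u * a) (ball 0 1) (ball 0 1) := by
    intro a ha
    rw [mem_ball_zero_iff] at ha ⊢
    rwa [norm_mul, hu, one_mul]
  refine ⟨fun a => discShift ζ (u * a), ?_, ?_, ?_, ?_⟩
  · exact (differentiableOn_discShift hζ).comp (by fun_prop) hmaps
  · exact fun a ha => discShift_mem_ball hζ (hmaps ha)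
  · simp [discShift]
  · have hr : Real.tanh (poincareDist ζ ξ) = ‖m‖ := by
      rw [poincareDist_comm, poincareDist_eq_artanh hξ hζ, Real.tanh_artanh]
      exact ⟨by linarith [norm_nonneg m], mem_ball_zero_iff.1 hmb⟩
    simp only [hr, hum]
    exact discShift_discShift_neg hζ hξ

/-! ### Chains of discs and the Kobayashi pseudodistance -/

variable {d : ℕ} {Ω : Set (EuclideanSpace ℂ (Fin d))} {z w p : EuclideanSpace ℂ (Fin d)} {ℓ ℓ' : ℝ}

lemma DiscChain.nonneg (h : DiscChain Ω z w ℓ) : 0 ≤ ℓ := by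
  induction h with
  | nil z hz => exact le_rfl
  | cons z z' w ℓ f ζ ξ hf hfΩ hζ hξ hz hz' tail ih => linarith [poincareDist_nonneg hζ hξ]

lemma DiscChain.trans (h : DiscChain Ω z w ℓ) (h' : DiscChain Ω w p ℓ') :
    DiscChain Ω z p (ℓ + ℓ') := by
  induction h with
  | nil z hz => simpa using h'
  | cons z z' w ℓ f ζ ξ hf hfΩ hζ hξ hz hz' tail ih =>
    rw [add_assoc]
    exact .cons z z' p _ f ζ ξ hf hfΩ hζ hξ hz hz' (ih h')

lemma DiscChain.single {f : ℂ → EuclideanSpace ℂ (Fin d)} (hf : DifferentiableOn ℂ f (ball 0 1))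
    (hfΩ : Set.MapsTo f (ball 0 1) Ω) {ζ ξ : ℂ} (hζ : ζ ∈ ball (0 : ℂ) 1)
    (hξ : ξ ∈ ball (0 : ℂ) 1) : DiscChain Ω (f ζ) (f ξ) (poincareDist ζ ξ) := by
  simpa using DiscChain.cons (f ζ) (f ξ) (f ξ) 0 f ζ ξ hf hfΩ hζ hξ rfl rfl (.nil _ (hfΩ hξ))

lemma DiscChain.symm (h : DiscChain Ω z w ℓ) : DiscChain Ω w z ℓ := by
  induction h with
  | nil z hz => exact .nil z hz
  | cons z z' w ℓ f ζ ξ hf hfΩ hζ hξ hz hz' tail ih =>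
    subst hz hz'
    rw [add_comm, poincareDist_comm]
    exact ih.trans (.single hf hfΩ hξ hζ)

lemma DiscChain.kobayashiDist_le (h : DiscChain Ω z w ℓ) : kobayashiDist Ω z w ≤ ℓ :=
  csInf_le ⟨0, fun _ h => h.nonneg⟩ h

lemma kobayashiDist_nonneg (Ω : Set (EuclideanSpace ℂ (Fin d))) (z w : EuclideanSpace ℂ (Fin d)) :
    0 ≤ kobayashiDist Ω z w :=
  Real.sInf_nonneg fun _ h => DiscChain.nonneg h

lemma kobayashiDist_self (hz : z ∈ Ω) : kobayashiDist Ω z z = 0 :=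
  le_antisymm (DiscChain.nil z hz).kobayashiDist_le (kobayashiDist_nonneg ..)

lemma kobayashiDist_comm (Ω : Set (EuclideanSpace ℂ (Fin d))) (z w : EuclideanSpace ℂ (Fin d)) :
    kobayashiDist Ω z w = kobayashiDist Ω w z := by
  unfold kobayashiDist
  congr 1
  ext ℓ
  exact ⟨DiscChain.symm, DiscChain.symm⟩

/-- Points of a Euclidean ball in `Ω` are joined to its centre by an affine disc. -/
lemma discChain_of_ball_subset {ρ : ℝ} (hρ : ball z ρ ⊆ Ω) (hw : w ∈ ball z ρ) :
    DiscChain Ω z w (Real.artanh (‖w - z‖ / ρ)) := by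
  have hwz : ‖w - z‖ < ρ := mem_ball_iff_norm.1 hw
  have hρ0 : 0 < ρ := (norm_nonneg _).trans_lt hwz
  rcases eq_or_ne w z with rfl | hne
  · simpa using DiscChain.nil w (hρ hw)
  have hn : 0 < ‖w - z‖ := norm_pos_iff.2 (sub_ne_zero.2 hne)
  let f : ℂ → EuclideanSpace ℂ (Fin d) := fun a => z + (a * ((ρ / ‖w - z‖ : ℝ) : ℂ)) • (w - z)
  have hf : DifferentiableOn ℂ f (ball 0 1) := by fun_prop
  have hfΩ : Set.MapsTo f (ball 0 1) Ω := by
    intro a ha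
    apply hρ
    rw [mem_ball_zero_iff] at ha
    rw [mem_ball_iff_norm]
    simp only [f, add_sub_cancel_left, norm_smul, norm_mul, Complex.norm_real]
    rw [Real.norm_of_nonneg (by positivity), mul_assoc, div_mul_cancel₀ _ hn.ne']
    nlinarith
  have h0 : (0 : ℂ) ∈ ball (0 : ℂ) 1 := by simp
  have h1 : ((‖w - z‖ / ρ : ℝ) : ℂ) ∈ ball (0 : ℂ) 1 := by
    rw [mem_ball_zero_iff, Complex.norm_real, Real.norm_of_nonneg (by positivity)]
    exact (div_lt_one hρ0).2 hwz
  have key := DiscChain.single hf hfΩ h0 h1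
  have e0 : f 0 = z := by simp [f]
  have e1 : f ((‖w - z‖ / ρ : ℝ) : ℂ) = w := by
    have : (‖w - z‖ / ρ) * (ρ / ‖w - z‖) = 1 := by field_simp
    simp only [f, ← Complex.ofReal_mul, this]
    simp
  have e2 : poincareDist 0 ((‖w - z‖ / ρ : ℝ) : ℂ) = Real.artanh (‖w - z‖ / ρ) := by
    rw [poincareDist_comm, poincareDist_eq_artanh h1 h0]
    simp only [discShift, neg_zero, map_zero, zero_mul, add_zero, div_one, Complex.norm_real]
    rw [Real.norm_of_nonneg (by positivity)]
  rwa [e0, e1, e2] at key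

/-- Being joined by a chain is an equivalence relation that holds locally. This excludes the default
value `sInf ∅ = 0` in `kobayashiDist`. -/
lemma exists_discChain (hopen : IsOpen Ω) (hconn : IsConnected Ω) (hz : z ∈ Ω) (hw : w ∈ Ω) :
    ∃ ℓ, DiscChain Ω z w ℓ := by
  refine hconn.isPreconnected.induction₂ (fun z w => ∃ ℓ, DiscChain Ω z w ℓ) ?_ ?_ ?_ hz hw
  · intro z hz
    obtain ⟨ρ, hρ, hb⟩ := Metric.isOpen_iff.1 hopen z hz
    filter_upwards [mem_nhdsWithin_of_mem_nhds (ball_mem_nhds z hρ)] with w hw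
    exact ⟨_, discChain_of_ball_subset hb hw⟩
  · rintro a b c - - - ⟨ℓ, h⟩ ⟨ℓ', h'⟩
    exact ⟨_, h.trans h'⟩
  · rintro a b - - ⟨ℓ, h⟩
    exact ⟨_, h.symm⟩

lemma exists_discChain_lt (hopen : IsOpen Ω) (hconn : IsConnected Ω) (hz : z ∈ Ω) (hw : w ∈ Ω)
    {r : ℝ} (hr : kobayashiDist Ω z w < r) : ∃ ℓ < r, DiscChain Ω z w ℓ := by
  obtain ⟨ℓ, h, hlt⟩ := exists_lt_of_csInf_lt (exists_discChain hopen hconn hz hw) hr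
  exact ⟨ℓ, hlt, h⟩

lemma kobayashiDist_triangle (hopen : IsOpen Ω) (hconn : IsConnected Ω) (hz : z ∈ Ω) (hw : w ∈ Ω)
    (hp : p ∈ Ω) : kobayashiDist Ω z p ≤ kobayashiDist Ω z w + kobayashiDist Ω w p := by
  refine le_of_forall_pos_le_add fun ε hε => ?_
  obtain ⟨ℓ, hℓ, h⟩ := exists_discChain_lt hopen hconn hz hw
    (r := kobayashiDist Ω z w + ε / 2) (by linarith)
  obtain ⟨ℓ', hℓ', h'⟩ := exists_discChain_lt hopen hconn hw hp
    (r := kobayashiDist Ω w p + ε / 2) (by linarith)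
  linarith [(h.trans h').kobayashiDist_le]

lemma tendsto_kobayashiDist_nhds (hopen : IsOpen Ω) (hz : z ∈ Ω) :
    Tendsto (fun w => kobayashiDist Ω z w) (𝓝 z) (𝓝 0) := by
  obtain ⟨ρ, hρ, hb⟩ := Metric.isOpen_iff.1 hopen z hz
  have hlim : Tendsto (fun w => Real.artanh (‖w - z‖ / ρ)) (𝓝 z) (𝓝 0) := by
    have h1 : ContinuousAt Real.artanh 0 := by
      unfold Real.artanh
      apply ContinuousAt.log
      · apply ContinuousAt.sqrt
        exact ContinuousAt.div (by fun_prop) (by fun_prop) (by norm_num)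
      · simp
    have h2 : Tendsto (fun w : EuclideanSpace ℂ (Fin d) => ‖w - z‖ / ρ) (𝓝 z) (𝓝 0) := by
      have : Continuous fun w : EuclideanSpace ℂ (Fin d) => ‖w - z‖ / ρ := by fun_prop
      simpa using this.tendsto z
    have := h1.tendsto.comp h2
    rwa [Real.artanh_zero] at this
  refine squeeze_zero' (Eventually.of_forall fun w => kobayashiDist_nonneg ..) ?_ hlim
  filter_upwards [ball_mem_nhds z hρ] with w hw
  exact (discChain_of_ball_subset hb hw).kobayashiDist_le

/-- A chain of discs of length `ℓ` carries a path from `z` to `w`, defined on all of `ℝ`, that is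
`1`-Lipschitz for the Kobayashi pseudodistance and continuous for the Euclidean one. -/
lemma DiscChain.exists_path (hopen : IsOpen Ω) (hconn : IsConnected Ω) (h : DiscChain Ω z w ℓ) :
    ∃ c : ℝ → EuclideanSpace ℂ (Fin d), Continuous c ∧ (∀ t, c t ∈ Ω) ∧
      (∀ s t, kobayashiDist Ω (c s) (c t) ≤ |s - t|) ∧ c 0 = z ∧ c ℓ = w := by
  induction h with
  | nil z hz =>
    exact ⟨fun _ => z, continuous_const, fun _ => hz,
      fun s t => (kobayashiDist_self hz).le.trans (abs_nonneg _), rfl, rfl⟩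
  | cons z z' w ℓ f ζ ξ hf hfΩ hζ hξ hz hz' tail ih =>
    obtain ⟨c₂, hc₂, hc₂Ω, hlip₂, hc₂0, hc₂ℓ⟩ := ih
    obtain ⟨φ, hφ, hφm, hφ0, hφ1⟩ := exists_disc_automorphism hζ hξ
    have hg : DifferentiableOn ℂ (f ∘ φ) (ball 0 1) := hf.comp hφ hφm
    have hgΩ : Set.MapsTo (f ∘ φ) (ball 0 1) Ω := hfΩ.comp hφm
    set L := poincareDist ζ ξ with hL
    have hL0 : 0 ≤ L := poincareDist_nonneg hζ hξ
    let c₁ : ℝ → EuclideanSpace ℂ (Fin d) := fun t => (f ∘ φ) (Real.tanh t)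
    have hc₁ : Continuous c₁ := hg.continuousOn.comp_continuous
      (Complex.continuous_ofReal.comp continuous_real_tanh) ofReal_tanh_mem_ball
    have hc₁Ω : ∀ t, c₁ t ∈ Ω := fun t => hgΩ (ofReal_tanh_mem_ball t)
    have hlip₁ : ∀ s t, kobayashiDist Ω (c₁ s) (c₁ t) ≤ |s - t| := fun s t => by
      rw [← poincareDist_tanh]
      exact (DiscChain.single hg hgΩ (ofReal_tanh_mem_ball s)
        (ofReal_tanh_mem_ball t)).kobayashiDist_le
    have hc₁0 : c₁ 0 = z := by simp only [c₁, Function.comp, hφ0, hz]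
    have hc₁L : c₁ L = z' := by simp only [c₁, Function.comp, hφ1, hz']
    -- Across the junction, the estimate goes through `z'`.
    have hmixed : ∀ s t, s ≤ L → L ≤ t → kobayashiDist Ω (c₁ s) (c₂ (t - L)) ≤ t - s := by
      intro s t hs ht
      have h1 := hlip₁ s L
      have h2 := hlip₂ 0 (t - L)
      rw [hc₁L, abs_of_nonpos (by linarith)] at h1
      rw [hc₂0, abs_of_nonpos (by linarith)] at h2
      have := kobayashiDist_triangle hopen hconn (hc₁Ω s) (hc₁L ▸ hc₁Ω L) (hc₂Ω (t - L))
      linarith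
    refine ⟨fun t => if t ≤ L then c₁ t else c₂ (t - L), ?_, ?_, ?_, ?_, ?_⟩
    · refine Continuous.if_le hc₁ (hc₂.comp (continuous_id.sub continuous_const)) continuous_id
        continuous_const ?_
      intro t ht
      subst ht
      simp [hc₂0, hc₁L]
    · intro t
      dsimp only
      split_ifs
      exacts [hc₁Ω t, hc₂Ω _]
    · intro s t
      dsimp only
      split_ifs with hs ht ht
      · exact hlip₁ s t
      · rw [abs_sub_comm, abs_of_nonneg (by linarith)]
        exact hmixed s t hs (not_le.1 ht).le
      · rw [kobayashiDist_comm, abs_of_nonneg (by linarith)]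
        exact hmixed t s ht (not_le.1 hs).le
      · simpa using hlip₂ (s - L) (t - L)
    · simp [hL0, hc₁0]
    · dsimp only
      split_ifs with h
      · have : ℓ = 0 := le_antisymm (by linarith) tail.nonneg
        subst this
        rw [add_zero, hc₁L, ← hc₂0, hc₂ℓ]
      · simp [hc₂ℓ]

end Kobayashi

namespace Kobayashi

/-! ### The topology and the geodesics of a complete hyperbolic domain -/

variable {d : ℕ} {Ω : Set (EuclideanSpace ℂ (Fin d))}

lemma continuousOn_kobayashiDist (hopen : IsOpen Ω) (hconn : IsConnected Ω)
    {o : EuclideanSpace ℂ (Fin d)} (ho : o ∈ Ω) : ContinuousOn (kobayashiDist Ω o) Ω := by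
  intro z hz
  refine ContinuousAt.continuousWithinAt ?_
  rw [ContinuousAt, tendsto_iff_dist_tendsto_zero]
  refine squeeze_zero' (Eventually.of_forall fun _ => dist_nonneg) ?_
    (tendsto_kobayashiDist_nhds hopen hz)
  filter_upwards [hopen.mem_nhds hz] with w hw
  rw [Real.dist_eq, abs_le]
  have h1 := kobayashiDist_triangle hopen hconn ho hz hw
  have h2 := kobayashiDist_triangle hopen hconn ho hw hz
  rw [kobayashiDist_comm Ω w z] at h2
  constructor <;> linarith

/-- **Barth's theorem**: the distance of a hyperbolic domain dominates the Euclidean topology. -/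
lemma exists_forall_kobayashiDist_lt_imp_dist_lt (hopen : IsOpen Ω) (hconn : IsConnected Ω)
    (hhyp : IsHyperbolic Ω) {z : EuclideanSpace ℂ (Fin d)} (hz : z ∈ Ω) {ε : ℝ} (hε : 0 < ε) :
    ∃ δ > 0, ∀ w ∈ Ω, kobayashiDist Ω z w < δ → dist w z < ε := by
  obtain ⟨ρ, hρ, hb⟩ := Metric.nhds_basis_closedBall.mem_iff.1 (hopen.mem_nhds hz)
  set r := min ρ ε with hr
  have hr0 : 0 < r := lt_min hρ hε
  have hsub : sphere z r ⊆ Ω := fun w hw =>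
    hb (closedBall_subset_closedBall (min_le_left _ _) (sphere_subset_closedBall hw))
  obtain ⟨δ, hδ, hmin⟩ : ∃ δ > 0, ∀ w ∈ sphere z r, δ ≤ kobayashiDist Ω z w := by
    -- The sphere is empty when `d = 0`.
    rcases (sphere z r).eq_empty_or_nonempty with h | h
    · exact ⟨1, one_pos, by simp [h]⟩
    obtain ⟨m, hm, hmin⟩ := (isCompact_sphere z r).exists_isMinOn h
      ((continuousOn_kobayashiDist hopen hconn hz).mono hsub)
    refine ⟨_, (kobayashiDist_nonneg Ω z m).lt_of_ne' fun h0 => ?_, fun w hw => hmin hw⟩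
    have := hhyp z hz m (hsub hm) h0
    rw [mem_sphere, this, dist_self] at hm
    exact hr0.ne hm
  refine ⟨δ, hδ, fun w hw hlt => ?_⟩
  by_contra! hge
  -- The path along a chain shorter than `δ` would cross the sphere, all of whose points are at
  -- Kobayashi distance at least `δ` from `z`.
  obtain ⟨ℓ, hℓ, hchain⟩ := exists_discChain_lt hopen hconn hz hw hlt
  obtain ⟨c, hc, hcΩ, hlip, hc0, hcℓ⟩ := hchain.exists_path hopen hconn
  have hcont : ContinuousOn (fun t => dist (c t) z) (Set.Icc 0 ℓ) :=
    (hc.dist continuous_const).continuousOn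
  obtain ⟨s, hs, hsr⟩ := intermediate_value_Icc hchain.nonneg hcont
    (show r ∈ Set.Icc (dist (c 0) z) (dist (c ℓ) z) by
      rw [hc0, hcℓ, dist_self]
      exact ⟨hr0.le, (min_le_right _ _).trans hge⟩)
  have h1 := hmin (c s) (mem_sphere.2 hsr)
  have h2 := hlip 0 s
  rw [hc0, zero_sub, abs_neg, abs_of_nonneg hs.1] at h2
  linarith [hs.2]

lemma IsGeodesicOn.continuousOn (hopen : IsOpen Ω) (hconn : IsConnected Ω)
    (hhyp : IsHyperbolic Ω) {γ : ℝ → EuclideanSpace ℂ (Fin d)} {a b : ℝ}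
    (hγ : IsGeodesicOn Ω γ a b) : ContinuousOn γ (Set.Icc a b) := by
  intro s hs
  refine Metric.continuousWithinAt_iff.2 fun ε hε => ?_
  obtain ⟨δ, hδ, h⟩ :=
    exists_forall_kobayashiDist_lt_imp_dist_lt hopen hconn hhyp (hγ.1 hs) hε
  refine ⟨δ, hδ, fun t ht hts => h _ (hγ.1 ht) ?_⟩
  rwa [hγ.2 s hs t ht, ← Real.dist_eq, dist_comm]

lemma IsGeodesicOn.mono {γ : ℝ → EuclideanSpace ℂ (Fin d)} {a b a' b' : ℝ}
    (hγ : IsGeodesicOn Ω γ a b) (ha : a ≤ a') (hb : b' ≤ b) : IsGeodesicOn Ω γ a' b' :=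
  have h := Set.Icc_subset_Icc ha hb
  ⟨hγ.1.mono_left h, fun s hs t ht => hγ.2 s (h hs) t (h ht)⟩

/-- The points of `Ω`, as a type that carries no metric of its own. -/
@[ext]
structure KobayashiSpace (Ω : Set (EuclideanSpace ℂ (Fin d))) : Type where
  /-- The underlying point of `ℂᵈ`. -/
  val : EuclideanSpace ℂ (Fin d)
  mem : val ∈ Ω

/-- The Kobayashi distance of a hyperbolic domain as a metric. -/
@[reducible]
noncomputable def kobayashiMetricSpace (hopen : IsOpen Ω) (hconn : IsConnected Ω)
    (hhyp : IsHyperbolic Ω) : MetricSpace (KobayashiSpace Ω) where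
  dist p q := kobayashiDist Ω p.val q.val
  dist_self p := kobayashiDist_self p.mem
  dist_comm p q := kobayashiDist_comm Ω p.val q.val
  dist_triangle p q r := kobayashiDist_triangle hopen hconn p.mem q.mem r.mem
  eq_of_dist_eq_zero {p q} h := KobayashiSpace.ext (hhyp p.val p.mem q.val q.mem h)

/-- A hyperbolic domain is a length space for its Kobayashi distance, and the topology of this
space is the Euclidean one. -/
lemma exists_metric_model (hopen : IsOpen Ω) (hconn : IsConnected Ω) (hhyp : IsHyperbolic Ω) :
    ∃ (X : Type) (_ : MetricSpace X) (ι : X → EuclideanSpace ℂ (Fin d)),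
      IsOpenEmbedding ι ∧ Set.range ι = Ω ∧ (∀ p q, dist p q = kobayashiDist Ω (ι p) (ι q)) ∧
      IsLengthSpace X := by
  let _ := kobayashiMetricSpace hopen hconn hhyp
  have hdist : ∀ p q : KobayashiSpace Ω, dist p q = kobayashiDist Ω p.val q.val := fun _ _ => rfl
  refine ⟨KobayashiSpace Ω, inferInstance, KobayashiSpace.val, ?_, ?_, hdist, ?_⟩
  · refine .of_continuous_injective_isOpenMap ?_ (fun _ _ => KobayashiSpace.ext) (.of_nhds_le ?_)
    · refine Metric.continuous_iff.2 fun p ε hε => ?_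
      obtain ⟨δ, hδ, h⟩ :=
        exists_forall_kobayashiDist_lt_imp_dist_lt hopen hconn hhyp p.mem hε
      refine ⟨δ, hδ, fun q hq => h q.val q.mem ?_⟩
      rwa [dist_comm] at hq
    · intro p s hs
      obtain ⟨ε, hε, hb⟩ := Metric.mem_nhds_iff.1 (mem_map.1 hs)
      filter_upwards [hopen.mem_nhds p.mem,
        (tendsto_kobayashiDist_nhds hopen p.mem).eventually_lt_const hε] with w hw hlt
      have hmem : (⟨w, hw⟩ : KobayashiSpace Ω) ∈ ball p ε := by
        rwa [mem_ball, dist_comm, hdist]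
      exact hb hmem
  · ext z
    exact ⟨fun ⟨p, hp⟩ => hp ▸ p.mem, fun hz => ⟨⟨z, hz⟩, rfl⟩⟩
  · intro p q r hr
    obtain ⟨ℓ, hℓ, hchain⟩ := exists_discChain_lt hopen hconn p.mem q.mem hr
    obtain ⟨c, -, hcΩ, hlip, hc0, hcℓ⟩ := hchain.exists_path hopen hconn
    refine ⟨ℓ, hchain.nonneg, hℓ, fun t => ⟨c t, hcΩ t⟩, ?_, KobayashiSpace.ext hc0,
      KobayashiSpace.ext hcℓ⟩
    refine LipschitzWith.of_dist_le_mul fun s t => ?_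
    rw [NNReal.coe_one, one_mul]
    exact hlip s t

/-- The model is locally compact as an open piece of ℂᵈ, so Hopf–Rinow applies. -/
lemma exists_proper_metric_model (hopen : IsOpen Ω) (hconn : IsConnected Ω)
    (hcomplete : IsCompleteHyperbolic Ω) :
    ∃ (X : Type) (_ : MetricSpace X) (_ : ProperSpace X) (ι : X → EuclideanSpace ℂ (Fin d)),
      IsOpenEmbedding ι ∧ Set.range ι = Ω ∧ (∀ p q, dist p q = kobayashiDist Ω (ι p) (ι q)) ∧
      IsLengthSpace X := by
  obtain ⟨X, _, ι, hι, hrange, hdist, hlen⟩ := exists_metric_model hopen hconn hcomplete.1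
  have hmem : ∀ p, ι p ∈ Ω := fun p => hrange ▸ Set.mem_range_self p
  have : LocallyCompactSpace X := hι.locallyCompactSpace
  have : CompleteSpace X := by
    refine Metric.complete_of_cauchySeq_tendsto fun u hu => ?_
    obtain ⟨p, hp, hlim⟩ := hcomplete.2 (ι ∘ u) (fun n => hmem _) (by
      simpa only [hdist, Function.comp_apply] using Metric.cauchySeq_iff.1 hu)
    obtain ⟨q, rfl⟩ := hrange.symm ▸ hp
    refine ⟨q, tendsto_iff_dist_tendsto_zero.2 ?_⟩
    simpa only [hdist, Function.comp_apply] using hlim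
  exact ⟨X, _, hlen.properSpace, ι, hι, hrange, hdist, hlen⟩

lemma isCompact_setOf_kobayashiDist_le (hopen : IsOpen Ω) (hconn : IsConnected Ω)
    (hcomplete : IsCompleteHyperbolic Ω) {o : EuclideanSpace ℂ (Fin d)} (ho : o ∈ Ω) (r : ℝ) :
    IsCompact {z | z ∈ Ω ∧ kobayashiDist Ω o z ≤ r} := by
  obtain ⟨X, _, _, ι, hι, rfl, hdist, -⟩ := exists_proper_metric_model hopen hconn hcomplete
  obtain ⟨p, rfl⟩ := ho
  convert (isCompact_closedBall p r).image hι.continuous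
  ext z
  constructor
  · rintro ⟨⟨q, rfl⟩, hq⟩
    exact ⟨q, by rwa [mem_closedBall, dist_comm, hdist], rfl⟩
  · rintro ⟨q, hq, rfl⟩
    exact ⟨⟨q, rfl⟩, by rwa [mem_closedBall, dist_comm, hdist] at hq⟩

lemma exists_isGeodesicOn (hopen : IsOpen Ω) (hconn : IsConnected Ω)
    (hcomplete : IsCompleteHyperbolic Ω) {z w : EuclideanSpace ℂ (Fin d)} (hz : z ∈ Ω)
    (hw : w ∈ Ω) :
    ∃ γ : ℝ → EuclideanSpace ℂ (Fin d), IsGeodesicOn Ω γ 0 (kobayashiDist Ω z w) ∧ γ 0 = z ∧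
      γ (kobayashiDist Ω z w) = w := by
  obtain ⟨X, _, _, ι, -, rfl, hdist, hlen⟩ := exists_proper_metric_model hopen hconn hcomplete
  obtain ⟨p, rfl⟩ := hz
  obtain ⟨q, rfl⟩ := hw
  obtain ⟨γ, h0, h1, hγ⟩ := hlen.exists_geodesic p q
  rw [← hdist]
  refine ⟨ι ∘ γ, ⟨fun t _ => ⟨γ t, rfl⟩, fun s hs t ht => ?_⟩, congrArg ι h0, congrArg ι h1⟩
  rw [← hγ s hs t ht, hdist]
  rfl

/-! ### Behaviour at the boundary -/

/-- A closed Kobayashi ball is compact in Ω, so its complement is a neighbourhood of `x`. -/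
lemma eventually_lt_kobayashiDist (hopen : IsOpen Ω) (hconn : IsConnected Ω)
    (hcomplete : IsCompleteHyperbolic Ω) {o x : EuclideanSpace ℂ (Fin d)} (ho : o ∈ Ω)
    (hx : x ∈ frontier Ω) (r : ℝ) : ∀ᶠ w in 𝓝[Ω] x, r < kobayashiDist Ω o w := by
  have hxΩ : x ∉ Ω := (hopen.frontier_eq ▸ hx).2
  have hK := isCompact_setOf_kobayashiDist_le hopen hconn hcomplete ho r
  filter_upwards [mem_nhdsWithin_of_mem_nhds (hK.isClosed.isOpen_compl.mem_nhds fun h => hxΩ h.1),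
    self_mem_nhdsWithin] with w hw hwΩ
  by_contra! h
  exact hw ⟨hwΩ, h⟩

lemma exists_forall_kobayashiDist_le (hopen : IsOpen Ω) (hconn : IsConnected Ω)
    {o : EuclideanSpace ℂ (Fin d)} (ho : o ∈ Ω) {K : Set (EuclideanSpace ℂ (Fin d))}
    (hK : IsCompact K) (hKΩ : K ⊆ Ω) : ∃ C, ∀ p ∈ K, kobayashiDist Ω o p ≤ C := by
  obtain ⟨C, hC⟩ := hK.bddAbove_image ((continuousOn_kobayashiDist hopen hconn ho).mono hKΩ)
  exact ⟨C, fun p hp => hC (Set.mem_image_of_mem _ hp)⟩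

lemma IsGeodesicOn.kobayashiDist_eq_of_zero {γ : ℝ → EuclideanSpace ℂ (Fin d)} {L t : ℝ}
    (hγ : IsGeodesicOn Ω γ 0 L) (ht : t ∈ Set.Icc 0 L) : kobayashiDist Ω (γ 0) (γ t) = t := by
  rw [hγ.2 0 ⟨le_rfl, ht.1.trans ht.2⟩ t ht, zero_sub, abs_neg, abs_of_nonneg ht.1]

/-- Geodesics from `o` that end near `x` are close to `x` from a uniform time on. -/
lemma exists_forall_isGeodesicOn_dist_lt (hopen : IsOpen Ω) (hconn : IsConnected Ω)
    (hhyp : IsHyperbolic Ω) (hvis : HasGeodesicVisibility Ω) {o x : EuclideanSpace ℂ (Fin d)}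
    (ho : o ∈ Ω) (hx : x ∈ frontier Ω) {r : ℝ} (hr : 0 < r) :
    ∃ T : ℝ, ∃ δ > 0, ∀ (γ : ℝ → EuclideanSpace ℂ (Fin d)) (L : ℝ), IsGeodesicOn Ω γ 0 L →
      γ 0 = o → dist (γ L) x < δ → ∀ t ∈ Set.Icc 0 L, T ≤ t → dist (γ t) x < r := by
  by_contra! hcon
  -- A geodesic far from `x` after time `n` must cross the sphere of radius `r` to end near `x`.
  -- Crossing points lie in a compact set even if Ω is unbounded.
  have hcross : ∀ n : ℕ, ∃ (γ : ℝ → EuclideanSpace ℂ (Fin d)) (L s : ℝ), IsGeodesicOn Ω γ 0 L ∧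
      γ 0 = o ∧ dist (γ L) x < r / ((n : ℝ) + 1) ∧ s ∈ Set.Icc 0 L ∧ (n : ℝ) ≤ s ∧
      dist (γ s) x = r := by
    intro n
    obtain ⟨γ, L, hγ, h0, hL, t, ht, hnt, hrt⟩ := hcon n (r / ((n : ℝ) + 1)) (by positivity)
    have hcont : ContinuousOn (fun s => dist (γ s) x) (Set.Icc t L) :=
      (continuous_id.dist continuous_const).comp_continuousOn
        ((hγ.mono ht.1 le_rfl).continuousOn hopen hconn hhyp)
    have hLr : dist (γ L) x ≤ r := hL.le.trans <|
      (div_le_self hr.le (by linarith [n.cast_nonneg (α := ℝ)]))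
    obtain ⟨s, hs, hsr⟩ := intermediate_value_Icc' ht.2 hcont ⟨hLr, hrt⟩
    exact ⟨γ, L, s, hγ, h0, hL, ⟨ht.1.trans hs.1, hs.2⟩, hnt.trans hs.1, hsr⟩
  choose γ L s hγ h0 hL hs hns hsr using hcross
  obtain ⟨y, hy, φ, hφ, hlim⟩ := (isCompact_sphere x r).tendsto_subseq (x := fun n => γ n (s n))
    fun n => mem_sphere.2 (hsr n)
  have hmem : ∀ n, γ n (s n) ∈ Ω := fun n => (hγ n).1 (hs n)
  have hks : ∀ n, kobayashiDist Ω o (γ n (s n)) = s n := fun n => by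
    simpa only [h0] using (hγ n).kobayashiDist_eq_of_zero (hs n)
  have hφtop : Tendsto (fun n => (φ n : ℝ)) atTop atTop :=
    tendsto_natCast_atTop_atTop.comp hφ.tendsto_atTop
  have hyΩ : y ∉ Ω := by
    intro hyΩ
    have h1 : Tendsto (fun n => kobayashiDist Ω o (γ (φ n) (s (φ n)))) atTop
        (𝓝 (kobayashiDist Ω o y)) :=
      ((continuousOn_kobayashiDist hopen hconn ho).continuousAt
        (hopen.mem_nhds hyΩ)).tendsto.comp hlim
    refine not_tendsto_nhds_of_tendsto_atTop (tendsto_atTop_mono (fun n => ?_) hφtop) _ h1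
    rw [hks]
    exact hns _
  have hyfr : y ∈ frontier Ω := by
    rw [hopen.frontier_eq]
    exact ⟨mem_closure_of_tendsto hlim (Eventually.of_forall fun n => hmem _), hyΩ⟩
  have hyx : y ≠ x := by
    rintro rfl
    rw [mem_sphere, dist_self] at hy
    exact hr.ne hy
  -- The arcs after the crossing times join points near `y` to points near `x`, so they meet `K`;
  -- but there `k(o, ·)` is the time, at least `n`, hence unbounded on `K`.
  obtain ⟨U, hU, V, hV, -, K, hK, hKΩ, hmeet⟩ := hvis y hyfr x hx hyx
  obtain ⟨C, hC⟩ := exists_forall_kobayashiDist_le hopen hconn ho hK hKΩ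
  have hend : Tendsto (fun n => γ n (L n)) atTop (𝓝 x) := by
    rw [tendsto_iff_dist_tendsto_zero]
    refine squeeze_zero (fun _ => dist_nonneg) (fun n => (hL n).le) ?_
    simpa [div_eq_mul_inv] using tendsto_one_div_add_atTop_nhds_zero_nat.const_mul r
  obtain ⟨n, hnU, hnV, hnC⟩ := ((hlim.eventually_mem hU).and
    (((hend.comp hφ.tendsto_atTop).eventually_mem hV).and (hφtop.eventually_gt_atTop C))).exists
  obtain ⟨t, ht, htK⟩ := hmeet (γ (φ n)) (s (φ n)) (L (φ n)) (hs _).2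
    ((hγ _).mono (hs _).1 le_rfl) hnU hnV
  have h1 := hC _ htK
  have h2 := (hγ (φ n)).kobayashiDist_eq_of_zero ⟨(hs _).1.trans ht.1, ht.2⟩
  rw [h0] at h2
  linarith [hns (φ n), ht.1]

lemma mem_closure_bigHorosphere (hopen : IsOpen Ω) (hconn : IsConnected Ω)
    (hcomplete : IsCompleteHyperbolic Ω) (hvis : HasGeodesicVisibility Ω)
    {o x : EuclideanSpace ℂ (Fin d)} (ho : o ∈ Ω) (hx : x ∈ frontier Ω) (R : ℝ) :
    x ∈ closure (bigHorosphere Ω o x R) := by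
  refine Metric.mem_closure_iff.2 fun r hr => ?_
  obtain ⟨T, δ, hδ, htrap⟩ := exists_forall_isGeodesicOn_dist_lt hopen hconn hcomplete.1 hvis ho hx
    (half_pos hr)
  obtain ⟨t, htT, ht0, htR⟩ : ∃ t, T ≤ t ∧ 0 ≤ t ∧ 1 - (1 / 2) * Real.log R ≤ t :=
    ⟨max T (max 0 (1 - (1 / 2) * Real.log R)), by simp, by simp, by simp⟩
  have hpt : ∀ᶠ w in 𝓝[Ω] x, ∃ g ∈ Ω, kobayashiDist Ω o g ≤ t ∧
      kobayashiDist Ω g w = kobayashiDist Ω o w - t ∧ dist g x < r / 2 := by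
    filter_upwards [eventually_lt_kobayashiDist hopen hconn hcomplete ho hx t,
      mem_nhdsWithin_of_mem_nhds (ball_mem_nhds x hδ), self_mem_nhdsWithin] with w hwt hwδ hwΩ
    obtain ⟨γ, hγ, h0, h1⟩ := exists_isGeodesicOn hopen hconn hcomplete ho hwΩ
    set L := kobayashiDist Ω o w with hL
    have ht : t ∈ Set.Icc 0 L := ⟨ht0, hwt.le⟩
    refine ⟨γ t, hγ.1 ht, ?_, ?_, htrap γ L hγ h0 (by rwa [h1]) t ht htT⟩
    · rw [← h0, hγ.kobayashiDist_eq_of_zero ht]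
    · rw [← h1, hγ.2 t ht L ⟨ht0.trans hwt.le, le_rfl⟩, abs_of_nonpos (by linarith)]
      ring
  have : NeBot (𝓝[Ω] x) := mem_closure_iff_nhdsWithin_neBot.1 (frontier_subset_closure hx)
  obtain ⟨g, hg⟩ := hpt.choice
  -- `g` varies with `w`, while the horosphere needs one fixed point: hence the cluster point.
  obtain ⟨z, ⟨hzΩ, -⟩, hz⟩ := (isCompact_setOf_kobayashiDist_le hopen hconn hcomplete ho t)
    |>.exists_mapClusterPt_of_frequently (l := 𝓝[Ω] x) (f := g)
      (hg.mono fun w h => ⟨h.1, h.2.1⟩).frequently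
  refine ⟨z, ⟨hzΩ, ?_⟩, ?_⟩
  -- Replacing `g w` by `z` costs less than `1 / 2`; the `1` in the choice of `t` leaves room for
  -- this and for strictness.
  · have hfreq : ∃ᶠ w in 𝓝[Ω] x, kobayashiDist Ω z w - kobayashiDist Ω o w ≤ 1 / 2 - t := by
      refine ((hz.frequently ((tendsto_kobayashiDist_nhds hopen hzΩ).eventually_lt_const
        (half_pos one_pos))).and_eventually (hg.and self_mem_nhdsWithin)).mono ?_
      rintro w ⟨h1, ⟨h2, -, h3, -⟩, hwΩ⟩
      linarith [kobayashiDist_triangle hopen hconn hzΩ h2 hwΩ]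
    refine (liminf_le_of_frequently_le' (hfreq.mono fun w h => EReal.coe_le_coe_iff.2 h)).trans_lt
      (EReal.coe_lt_coe_iff.2 (by linarith))
  · obtain ⟨w, h1, h2⟩ := ((hz.frequently (ball_mem_nhds z (half_pos hr))).and_eventually hg).exists
    rw [dist_comm]
    linarith [dist_triangle_left z x (g w), h2.2.2.2]

lemma eq_of_mem_closure_bigHorosphere (hopen : IsOpen Ω) (hconn : IsConnected Ω)
    (hcomplete : IsCompleteHyperbolic Ω) (hvis : HasGeodesicVisibility Ω)
    {o x y : EuclideanSpace ℂ (Fin d)} (ho : o ∈ Ω) (hx : x ∈ frontier Ω) {R : ℝ}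
    (hyH : y ∈ closure (bigHorosphere Ω o x R)) (hy : y ∈ frontier Ω) : y = x := by
  by_contra hyx
  obtain ⟨U, hU, V, hV, -, K, hK, hKΩ, hmeet⟩ := hvis y hy x hx hyx
  obtain ⟨C, hC⟩ := exists_forall_kobayashiDist_le hopen hconn ho hK hKΩ
  have hfar := eventually_nhdsWithin_iff.1
    (eventually_lt_kobayashiDist hopen hconn hcomplete ho hy ((1 / 2) * Real.log R + 2 * C))
  obtain ⟨z, ⟨hzΩ, hzH⟩, hzfar, hzU⟩ :=
    ((mem_closure_iff_frequently.1 hyH).and_eventually (hfar.and hU)).exists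
  have hVev : ∀ᶠ w in 𝓝[Ω] x, w ∈ V := mem_nhdsWithin_of_mem_nhds hV
  -- A small lower limit gives the inequality only for some `w` arbitrarily near `x`; one such `w`
  -- in `V` suffices.
  obtain ⟨w, hw, hwV, hwΩ⟩ := ((frequently_lt_of_liminf_lt (by isBoundedDefault) hzH).and_eventually
    (hVev.and self_mem_nhdsWithin)).exists
  rw [EReal.coe_lt_coe_iff] at hw
  obtain ⟨γ, hγ, h0, h1⟩ := exists_isGeodesicOn hopen hconn hcomplete hzΩ hwΩ
  set L := kobayashiDist Ω z w with hL
  have hL0 : 0 ≤ L := kobayashiDist_nonneg ..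
  obtain ⟨t, ht, htK⟩ := hmeet γ 0 L hL0 hγ (h0 ▸ hzU) (h1 ▸ hwV)
  have hpΩ := hKΩ htK
  have a1 : kobayashiDist Ω z (γ t) = t := h0 ▸ hγ.kobayashiDist_eq_of_zero ht
  have a2 : kobayashiDist Ω (γ t) w = L - t := by
    have := hγ.2 t ht L ⟨hL0, le_rfl⟩
    rw [h1, abs_of_nonpos (by linarith [ht.2])] at this
    linarith
  have a3 := kobayashiDist_triangle hopen hconn ho hpΩ hzΩ
  have a4 := kobayashiDist_triangle hopen hconn ho hpΩ hwΩ
  rw [kobayashiDist_comm Ω (γ t) z] at a3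
  linarith [hC _ htK, hzfar hzΩ]

end Kobayashi

theorem proposition1p2 (d : ℕ) (Ω : Set (EuclideanSpace ℂ (Fin d)))
    (hopen : IsOpen Ω) (hconn : IsConnected Ω)
    (hcomplete : Kobayashi.IsCompleteHyperbolic Ω)
    (hvis : Kobayashi.HasGeodesicVisibility Ω)
    (o : EuclideanSpace ℂ (Fin d)) (ho : o ∈ Ω)
    (x : EuclideanSpace ℂ (Fin d)) (hx : x ∈ frontier Ω)
    (R : ℝ) (hR : 0 < R) :
    closure (Kobayashi.bigHorosphere Ω o x R) ∩ frontier Ω = {x} := by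
  ext y
  constructor
  · rintro ⟨hyH, hy⟩
    exact Kobayashi.eq_of_mem_closure_bigHorosphere hopen hconn hcomplete hvis ho hx hyH hy
  · rintro rfl
    exact ⟨Kobayashi.mem_closure_bigHorosphere hopen hconn hcomplete hvis ho hx R, hx⟩
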